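/- Let $n\ge 0$, $p\ge 1$, let $X=[x_1\ \cdots\ x_p]\in\mathbb{R}^{n\times p}$, let $f:\mathbb{R}^n\to\mathbb{R}\cup\{+\infty\}$ be proper and lower semicontinuous (lsc) with domain $\operatorname{dom} f=\{u: f(u)<+\infty\}$, and let $\eta>0$. Consider $$(P)\qquad \min_{\beta}\ f(X\beta)+\eta\langle \mathbf 1,\beta\rangle\quad\text{subject to } \beta\in\mathbb{R}^p_+ ,$$ and, for $\mathcal I\subseteq\{1,\dots,p\}$, $$(P_{\mathcal I})\qquad \min_{\beta}\ f(X\beta)+\eta\langle \mathbf 1,\beta\rangle\quad\text{subject to } \beta\in\mathbb{R}^p_+,\ \beta_i=0\ \ \forall i\notin\mathcal I .$$ For $u\in\operatorname{dom} f$ let $\mathrm{d}f(u)(w)=\liminf_{\tau\searrow0,\,v\to w}\frac{f(u+\tau v)-f(u)}{\tau}$ be the subderivative, and for $\gamma\in[0,1]$ let $f_\gamma(u)=f(u)-\gamma\,\mathrm{d}f(u)(u)$ for $u\in\operatorname{dom} f$ and $f_\gamma(u)=+\infty$ otherwise. Let $g^\star(h)=\sup_u\{\langle h,u\rangle-g(u)\}$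 denote the convex conjugate, with $\operatorname{dom}g^\star=\{h: g^\star(h)<+\infty\}$. Assume the following. 1. (Star-type condition.) There are $y\in\operatorname{dom} f$ and $\psi_L\in\mathbb{R}$ such that $\operatorname{dom} f$ is star-convex with respect to $y$ and, for all $u\in\operatorname{dom} f$ and $\lambda\in(0,1)$, $$f(\lambda u+(1-\lambda)y)-\psi_L\le\lambda\,(f(u)-\psi_L)\quad\text{and}\quad f(\lambda u+(1-\lambda)y)\le f(u).$$ 2. (Range of $\eta$.) There are $\gamma\in[0,1]$, $h\in\operatorname{dom}(f_\gamma)^\star$ and $\alpha>0$ such that $$(1-\gamma)\,\eta\ \le\ -\min_{1\le i\le p}\langle x_i,h\rangle\ <\ \alpha\left[-(f_\gamma)^\star(h)-\psi_L\right]-\gamma\,\eta .$$ 3. (Vertex non-cover condition for $X$ and $\alpha y$.) $\alpha y\ne x_i$ for all $i$, and the set of vertices (extreme points) of $\operatorname{conv}\{x_1,\dots,x_p,\alpha y\}$ is exactly $\{x_1,\dots,x_p,\alpha y\}$. 4. (Hypotheses of the optimality condition.) * The objective $\beta\mapsto f(X\beta)+\eta\langle\mathbf 1,\beta\rangle+\delta(\beta;\mathbb{R}^p_+)$,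 where $\delta(\cdot\,;\mathbb{R}^p_+)$ is $0$ on $\mathbb{R}^p_+$ and $+\infty$ elsewhere, is proper and lsc, and (P) is feasible, i.e. $X\beta\in\operatorname{dom} f$ for some $\beta\in\mathbb{R}^p_+$. * $f$ is subdifferentially regular at every point $u$ of $\operatorname{dom} f\cap\{X\beta:\beta\in\mathbb{R}^p_+\}$; that is, the epigraph of $f$ is Clarke regular at $(u,f(u))$ (it is locally closed there and every limiting normal is a regular normal). * Either $X$ has rank $n$, or $f$ is convex and $\operatorname{dom} f$ cannot be separated from the range of $X$ (there is no hyperplane such that the two sets lie in its opposite closed half-spaces). Let $T=\left\{\sum_{i=1}^p\lambda_i(x_i-\alpha y):\lambda_i\ge0\right\}$, and let $\mathcal I\subseteq\{1,\dots,p\}$ be any set such that $i\in\mathcal I$ whenever $\{t(x_i-\alpha y):t\ge0\}$ is an extreme ray of $T$. Then $(P)$ and $(P_{\mathcal I})$ have the same optimal value and the same set of optimal solutions. In particular, $\{i:\beta^\star_i\ne0\}\subseteq\mathcal I$ for every optimal solution $\beta^\star$ of $(P)$. -/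

import Mathlib

open Set Filter Topology

noncomputable section

namespace PersistentReduction

/-! ### Extended-real-valued functions -/

/-- The (effective) domain of an extended-real-valued function. -/
def dom {V : Type*} (F : V → EReal) : Set V := {x | F x < ⊤}

/-- A proper function: nowhere `-∞`, and finite somewhere. -/
def IsProper {V : Type*} (F : V → EReal) : Prop := (∀ x, F x ≠ ⊥) ∧ (dom F).Nonempty

/-- The epigraph, as a subset of the Euclidean product `V × ℝ`. -/
def epigraph {V : Type*} (F : V → EReal) : Set (WithLp 2 (V × ℝ)) :=
  {q | F q.fst ≤ (q.snd : EReal)}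

/-- Convexity of an extended-real-valued function: its epigraph is convex. -/
def IsConvexFun {V : Type*} [NormedAddCommGroup V] [InnerProductSpace ℝ V] (F : V → EReal) : Prop :=
  Convex ℝ (epigraph F)

/-- The convex (Fenchel) conjugate `F⋆(h) = sup_u (⟨h, u⟩ - F u)`. -/
def conjugate {V : Type*} [NormedAddCommGroup V] [InnerProductSpace ℝ V]
    (F : V → EReal) (h : V) : EReal :=
  ⨆ u : V, (((inner ℝ h u : ℝ) : EReal) - F u)

/-- The subderivative
`dF(u)(w) = liminf_{τ ↘ 0, v → w} (F (u + τ v) - F u) / τ` (meaningful where `F u` is finite). -/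
def subderivative {V : Type*} [NormedAddCommGroup V] [InnerProductSpace ℝ V]
    (F : V → EReal) (u w : V) : EReal :=
  liminf (fun q : ℝ × V => ((q.1⁻¹ : ℝ) : EReal) * (F (u + q.1 • q.2) - F u)) (𝓝[>] (0 : ℝ) ×ˢ 𝓝 w)

open Classical in
/-- `F_γ(u) = F u - γ dF(u)(u)` for `u ∈ dom F`, and `+∞` outside the domain of `F`. -/
def fGamma {V : Type*} [NormedAddCommGroup V] [InnerProductSpace ℝ V]
    (F : V → EReal) (γ : ℝ) (u : V) : EReal :=
  if u ∈ dom F then F u - (γ : EReal) * subderivative F u u else ⊤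

/-! ### Clarke regularity and subdifferential regularity -/

/-- Regular (Fréchet) normals: `⟨v, x' - x⟩ ≤ o(‖x' - x‖)` for `x' → x` in `C`. -/
def regularNormalCone {H : Type*} [NormedAddCommGroup H] [InnerProductSpace ℝ H]
    (C : Set H) (x : H) : Set H :=
  {v | ∀ ε : ℝ, 0 < ε → ∀ᶠ x' in 𝓝[C] x, inner ℝ v (x' - x) ≤ ε * ‖x' - x‖}

/-- General (limiting) normals: limits of regular normals at points of `C` converging to `x`. -/
def limitingNormalCone {H : Type*} [NormedAddCommGroup H] [InnerProductSpace ℝ H]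
    (C : Set H) (x : H) : Set H :=
  {v | ∃ (xs vs : ℕ → H), (∀ k, xs k ∈ C) ∧ (∀ k, vs k ∈ regularNormalCone C (xs k)) ∧
    Tendsto xs atTop (𝓝 x) ∧ Tendsto vs atTop (𝓝 v)}

/-- `C` is Clarke regular at `x ∈ C`: it is locally closed at `x` and every normal at `x` is a
regular normal. -/
def ClarkeRegularAt {H : Type*} [NormedAddCommGroup H] [InnerProductSpace ℝ H]
    (C : Set H) (x : H) : Prop :=
  x ∈ C ∧ (∃ U ∈ 𝓝 x, IsClosed U ∧ IsClosed (C ∩ U)) ∧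
    limitingNormalCone C x ⊆ regularNormalCone C x

/-- `F` is subdifferentially regular at `u`: `F u` is finite and the epigraph of `F` is Clarke
regular at `(u, F u)`. -/
def SubdiffRegularAt {V : Type*} [NormedAddCommGroup V] [InnerProductSpace ℝ V]
    (F : V → EReal) (u : V) : Prop :=
  F u ≠ ⊥ ∧ F u ≠ ⊤ ∧ ClarkeRegularAt (epigraph F) (WithLp.toLp 2 (u, (F u).toReal))

/-- Two sets are separated by a hyperplane `{x | ⟨a, x⟩ = b}`, `a ≠ 0`, when they lie in opposite
closed half-spaces. -/
def CanBeSeparated {V : Type*} [NormedAddCommGroup V] [InnerProductSpace ℝ V]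
    (C D : Set V) : Prop :=
  ∃ (a : V) (b : ℝ), a ≠ 0 ∧ (∀ x ∈ C, inner ℝ a x ≤ b) ∧ (∀ x ∈ D, b ≤ inner ℝ a x)

/-! ### The optimization problem -/

variable {n p : ℕ}

/-- The `i`-th column of `X` as a point of Euclidean space. -/
def column (X : Matrix (Fin n) (Fin p) ℝ) (i : Fin p) : EuclideanSpace ℝ (Fin n) :=
  WithLp.toLp 2 (fun k => X k i)

/-- The vector `X β` as a point of Euclidean space. -/
def apply (X : Matrix (Fin n) (Fin p) ℝ) (β : Fin p → ℝ) : EuclideanSpace ℝ (Fin n) :=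
  WithLp.toLp 2 (X.mulVec β)

/-- `col₊(X) = {X β : β ≥ 0}`. -/
def colPlus (X : Matrix (Fin n) (Fin p) ℝ) : Set (EuclideanSpace ℝ (Fin n)) :=
  {u | ∃ β : Fin p → ℝ, 0 ≤ β ∧ u = apply X β}

/-- The cost `f (X β) + η ⟨1, β⟩`. -/
def cost (X : Matrix (Fin n) (Fin p) ℝ) (f : EuclideanSpace ℝ (Fin n) → EReal) (η : ℝ)
    (β : Fin p → ℝ) : EReal :=
  f (apply X β) + ((η * ∑ i, β i : ℝ) : EReal)

open Classical in
/-- The cost plus the indicator function of the nonnegative orthant. -/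
def objective (X : Matrix (Fin n) (Fin p) ℝ) (f : EuclideanSpace ℝ (Fin n) → EReal) (η : ℝ)
    (β : Fin p → ℝ) : EReal :=
  if 0 ≤ β then cost X f η β else ⊤

/-- The constraint set `{β : β ≥ 0}` of the original problem. -/
def orthant (p : ℕ) : Set (Fin p → ℝ) := {β | 0 ≤ β}

/-- The constraint set `{β : β ≥ 0, β i = 0 for all i ∉ I}` of the reduced problem. -/
def restrictedOrthant (I : Set (Fin p)) : Set (Fin p → ℝ) := {β | 0 ≤ β ∧ ∀ i, i ∉ I → β i = 0}

/-- The optimal value of minimizing `F` over `S`. -/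
def optimalValue {V : Type*} (F : V → EReal) (S : Set V) : EReal := ⨅ β ∈ S, F β

/-- The set of optimal solutions of minimizing `F` over `S` (points of infinite cost are infeasible,
hence not solutions). -/
def optimalSolutions {V : Type*} (F : V → EReal) (S : Set V) : Set V :=
  {β | β ∈ S ∧ F β < ⊤ ∧ ∀ β' ∈ S, F β ≤ F β'}

/-! ### The assumptions -/

/-- The star-type condition on the loss with reference point `y` and level `ψL`. -/
structure StarCondition {V : Type*} [NormedAddCommGroup V] [InnerProductSpace ℝ V]
    (f : V → EReal) (y : V) (ψL : ℝ) : Prop where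
  mem_dom : y ∈ dom f
  starConvex_dom : StarConvex ℝ y (dom f)
  epi_star : ∀ u ∈ dom f, ∀ l : ℝ, 0 < l → l < 1 →
    f (l • u + (1 - l) • y) - (ψL : EReal) ≤ (l : EReal) * (f u - (ψL : EReal))
  nondecreasing : ∀ u ∈ dom f, ∀ l : ℝ, 0 < l → l < 1 → f (l • u + (1 - l) • y) ≤ f u

/-- The vertex non-cover condition: `z` differs from all columns, and the columns together with `z`
are exactly the vertices of their convex hull. -/
def VertexNonCover (X : Matrix (Fin n) (Fin p) ℝ) (z : EuclideanSpace ℝ (Fin n)) : Prop :=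
  (∀ i, z ≠ column X i) ∧
    (convexHull ℝ (range (column X) ∪ {z})).extremePoints ℝ = range (column X) ∪ {z}

/-- The hypotheses under which the first-order optimality condition is considered. -/
structure OptimalityAssumptions (X : Matrix (Fin n) (Fin p) ℝ)
    (f : EuclideanSpace ℝ (Fin n) → EReal) (η : ℝ) : Prop where
  objective_proper : IsProper (objective X f η)
  objective_lsc : LowerSemicontinuous (objective X f η)
  feasible : ∃ β : Fin p → ℝ, 0 ≤ β ∧ apply X β ∈ dom f
  regular : ∀ u ∈ colPlus X ∩ dom f, SubdiffRegularAt f u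
  rank_or_convex : X.rank = n ∨
    (IsConvexFun f ∧ ¬ CanBeSeparated (dom f) (range (apply X)))

/-- The convex cone `{∑ i, l i (x i - z) : l ≥ 0}`. -/
def shiftedCone (X : Matrix (Fin n) (Fin p) ℝ) (z : EuclideanSpace ℝ (Fin n)) :
    Set (EuclideanSpace ℝ (Fin n)) :=
  {w | ∃ l : Fin p → ℝ, (∀ i, 0 ≤ l i) ∧ w = ∑ i, l i • (column X i - z)}

/-- The ray `{t d : t ≥ 0}`. -/
def ray {V : Type*} [NormedAddCommGroup V] [InnerProductSpace ℝ V] (d : V) : Set V :=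
  {w | ∃ t : ℝ, 0 ≤ t ∧ w = t • d}

/-- `R` is an extreme ray of `T`: a half-line from the origin which is an extreme subset (face). -/
def IsExtremeRay {V : Type*} [NormedAddCommGroup V] [InnerProductSpace ℝ V] (T R : Set V) : Prop :=
  (∃ d : V, d ≠ 0 ∧ R = ray d) ∧ IsExtreme ℝ T R

end PersistentReduction

end

open PersistentReduction

/-!
Restricting the problem to the columns on the extreme rays loses nothing because an optimal solution `β`
can use no other column.

Put `z = α y`, let `u = X β`, let `s` be the total weight of `β`, and suppose that `β i > 0` although
`x i - z` does not span an extreme ray of the cone generated by the `x j - z`. Since `x i` is a vertex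
of the convex hull of the `x j` and `z`, one can write `x i - z = ∑ l j (x j - z)` with `l ≥ 0` and
`∑ l j > 1` (`exists_sum_gt_one_of_not_isExtremeRay`). Replacing `x i` by this combination moves `u`
by a positive multiple of `y`, and a rescaling then yields a feasible point whose image is on the
segment from `u` to `y`. As `β` is optimal, the two inequalities of the star condition give
`s ≤ 1 / α` and `f u + η s ≤ ψL + η / α` (`sum_le_and_cost_le_of_not_isExtremeRay`).

On the other hand, if `df(u)(u) ≥ -η s`, then the Fenchel–Young inequality for `f_γ` reads
`⟨h, u⟩ - f_γ⋆(h) ≤ f u + γ η s`; with the assumed range of `η` and `s ≤ 1 / α` this gives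
`f u + η s > ψL + η / α`, a contradiction. The bound on `df(u)(u)` is a first-order condition that
needs a constraint qualification, but the argument only needs it approximately: relaxing the
constraint `u = X β` to a quadratic penalty produces points `u k → u` with `f (u k) → f u` and
`df(u k)(u k) ≥ -η s - o(1)` (`exists_tendsto_le_subderivative`), and the Fenchel–Young inequality
passes to the limit (`inner_sub_le_of_mem_optimalSolutions`).

Finally the star condition makes `y` a minimizer of `f`, so the cost is bounded below and coercive on
the orthant, and optimal solutions exist (`optimalSolutions_nonempty`). This transfers the inclusion
of supports into the equality of the optimal values and of the solution sets.
-/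

namespace PersistentReduction

/-! ### Extreme rays and extreme points -/

/-- If an extreme point of `convexHull A` is a finite convex combination of points of `A`, then
every point carrying positive weight coincides with it. -/
theorem eq_of_mem_extremePoints_of_sum_eq {E ι : Type*} [AddCommGroup E] [Module ℝ E] [Fintype ι]
    {A : Set E} {x : E} (hx : x ∈ (convexHull ℝ A).extremePoints ℝ) {w : ι → ℝ} {q : ι → E}
    (hw : ∀ j, 0 ≤ w j) (hsum : ∑ j, w j = 1) (hq : ∀ j, q j ∈ A)
    (hxq : x = ∑ j, w j • q j) {i : ι} (hi : 0 < w i) : q i = x := by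
  classical
  have hrest : ∑ j ∈ Finset.univ.erase i, w j = 1 - w i := by
    rw [← hsum, ← Finset.add_sum_erase _ _ (Finset.mem_univ i)]; ring
  have hsplit : x = w i • q i + ∑ j ∈ Finset.univ.erase i, w j • q j := by
    rw [hxq, Finset.add_sum_erase _ (fun j => w j • q j) (Finset.mem_univ i)]
  have hnn : 0 ≤ 1 - w i := hrest ▸ Finset.sum_nonneg fun j _ => hw j
  rcases hnn.eq_or_lt with h1 | h1
  · have h0 : ∀ j ∈ Finset.univ.erase i, w j = 0 :=
      (Finset.sum_eq_zero_iff_of_nonneg fun j _ => hw j).1 (hrest.trans h1.symm)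
    rw [Finset.sum_eq_zero fun j hj => by rw [h0 j hj, zero_smul], add_zero,
      show w i = 1 by linarith, one_smul] at hsplit
    exact hsplit.symm
  · have hc : (Finset.univ.erase i).centerMass w q ∈ convexHull ℝ A :=
      Finset.centerMass_mem_convexHull _ (fun j _ => hw j) (hrest ▸ h1) fun j _ => hq j
    refine hx.2 (subset_convexHull ℝ A (hq i)) hc ⟨w i, 1 - w i, hi, h1, by ring, ?_⟩
    rw [Finset.centerMass, hrest, smul_inv_smul₀ h1.ne']
    exact hsplit.symm

/-- A generator `x i - z` of the cone spanned by the `x j - z` that does not span an extreme ray is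
a nonnegative combination of the generators whose coefficients add up to *more than one*: a total
weight of at most one would exhibit the vertex `x i` as a convex combination of the `x j` and `z`. -/
theorem exists_sum_gt_one_of_not_isExtremeRay {n p : ℕ} {X : Matrix (Fin n) (Fin p) ℝ}
    {z : EuclideanSpace ℝ (Fin n)} (hver : VertexNonCover X z) {i : Fin p}
    (hi : ¬ IsExtremeRay (shiftedCone X z) (ray (column X i - z))) :
    ∃ l : Fin p → ℝ, (∀ j, 0 ≤ l j) ∧ 1 < ∑ j, l j ∧
      column X i - z = ∑ j, l j • (column X j - z) := by
  classical
  by_contra! hcon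
  apply hi
  refine ⟨⟨_, sub_ne_zero.2 (hver.1 i).symm, rfl⟩, ⟨?_, ?_⟩⟩
  · rintro _ ⟨t, ht, rfl⟩
    refine ⟨Pi.single i t, fun j => ?_, ?_⟩
    · by_cases hj : j = i
      · subst hj; simpa using ht
      · simp [hj]
    · rw [Finset.sum_eq_single i] <;> simp +contextual
  rintro _ ⟨l₁, hl₁, rfl⟩ _ ⟨l₂, hl₂, rfl⟩ _ ⟨t, ht, rfl⟩ ⟨a, b, ha, hb, -, hab⟩
  have hμ : ∑ j, (a * l₁ j + b * l₂ j) • (column X j - z) = t • (column X i - z) := by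
    rw [← hab, Finset.smul_sum, Finset.smul_sum, ← Finset.sum_add_distrib]
    exact Finset.sum_congr rfl fun j _ => by rw [add_smul, mul_smul, mul_smul]
  have hμ0 : ∀ j, 0 ≤ a * l₁ j + b * l₂ j := fun j =>
    add_nonneg (mul_nonneg ha.le (hl₁ j)) (mul_nonneg hb.le (hl₂ j))
  rcases ht.eq_or_lt with rfl | ht
  · -- A vanishing combination added to `x i - z` itself raises the total weight above one.
    rw [zero_smul] at hμ
    have hle := fun hlt => hcon (fun j => Pi.single (M := fun _ => ℝ) i 1 j + (a * l₁ j + b * l₂ j))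
      (fun j => add_nonneg (by by_cases hj : j = i <;> simp [hj]) (hμ0 j)) hlt
        (by simp_rw [add_smul (Pi.single (M := fun _ => ℝ) i 1 _), Finset.sum_add_distrib, hμ]
            rw [Finset.sum_eq_single i] <;> simp +contextual)
    rw [imp_false, not_lt, Finset.sum_add_distrib, Finset.sum_pi_single'] at hle
    simp only [Finset.mem_univ, if_true, add_le_iff_nonpos_right] at hle
    have h0 := (Finset.sum_eq_zero_iff_of_nonneg fun j _ => hμ0 j).1
      (le_antisymm hle (Finset.sum_nonneg fun j _ => hμ0 j))
    refine ⟨0, le_rfl, ?_⟩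
    rw [zero_smul]
    refine Finset.sum_eq_zero fun j hj => ?_
    have h1 := h0 j hj
    have : a * l₁ j = 0 := le_antisymm (by nlinarith [mul_nonneg hb.le (hl₂ j)])
      (mul_nonneg ha.le (hl₁ j))
    rw [(mul_eq_zero.1 this).resolve_left ha.ne', zero_smul]
  · set ν : Fin p → ℝ := fun j => t⁻¹ * (a * l₁ j + b * l₂ j) with hν
    have hν0 : ∀ j, 0 ≤ ν j := fun j => mul_nonneg (inv_nonneg.2 ht.le) (hμ0 j)
    have hνd : column X i - z = ∑ j, ν j • (column X j - z) := by
      simp_rw [hν, mul_smul, ← Finset.smul_sum, hμ]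
      rw [inv_smul_smul₀ ht.ne']
    have hle : ∑ j, ν j ≤ 1 := not_lt.1 fun hlt => hcon ν hν0 hlt hνd
    have hext : column X i ∈
        (convexHull ℝ (range (column X) ∪ {z})).extremePoints ℝ := by
      rw [hver.2]; exact Or.inl ⟨i, rfl⟩
    have hcol : ∀ j, 0 < l₁ j → column X j = column X i := by
      intro j hj
      have hνj : 0 < ν j := mul_pos (inv_pos.2 ht)
        (add_pos_of_pos_of_nonneg (mul_pos ha hj) (mul_nonneg hb.le (hl₂ j)))
      refine eq_of_mem_extremePoints_of_sum_eq (ι := Option (Fin p)) hext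
        (w := fun o => o.elim (1 - ∑ j, ν j) ν) (q := fun o => o.elim z (column X))
        ?_ ?_ ?_ ?_ (i := some j) hνj
      · rintro (_ | k)
        · exact sub_nonneg.2 hle
        · exact hν0 k
      · simp [Fintype.sum_option]
      · rintro (_ | k)
        · exact Or.inr rfl
        · exact Or.inl ⟨k, rfl⟩
      · simp only [Fintype.sum_option, Option.elim]
        have h1 : ∑ j, ν j • (column X j - z) = ∑ j, ν j • column X j - (∑ j, ν j) • z := by
          simp only [smul_sub, Finset.sum_sub_distrib, Finset.sum_smul]
        rw [sub_eq_iff_eq_add.1 (hνd.trans h1), sub_smul, one_smul]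
        abel
    refine ⟨∑ j, l₁ j, Finset.sum_nonneg fun j _ => hl₁ j, ?_⟩
    rw [Finset.sum_smul]
    refine Finset.sum_congr rfl fun j _ => ?_
    rcases (hl₁ j).eq_or_lt with h0 | h0
    · rw [← h0, zero_smul, zero_smul]
    · rw [hcol j h0]

/-! ### Lower semicontinuity in the extended reals -/

theorem lowerSemicontinuous_add_coe {W : Type*} [TopologicalSpace W] {F : W → EReal} {g : W → ℝ}
    (hF : LowerSemicontinuous F) (hg : Continuous g) :
    LowerSemicontinuous fun w => F w + (g w : EReal) :=
  hF.add' (continuous_coe_real_ereal.comp hg).lowerSemicontinuous fun _ =>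
    EReal.continuousAt_add (Or.inr (EReal.coe_ne_bot _)) (Or.inr (EReal.coe_ne_top _))

/-- A lower semicontinuous function attains its minimum over `S` if outside some compact part of `S`
it is no smaller than at a point of that part. -/
theorem exists_forall_le_of_isCompact {W : Type*} [TopologicalSpace W] {F : W → EReal}
    (hF : LowerSemicontinuous F) {S K : Set W} (hK : IsCompact K) {w₀ : W} (hw₀ : w₀ ∈ K)
    (hout : ∀ w ∈ S, w ∉ K → F w₀ ≤ F w) : ∃ w ∈ K, ∀ w' ∈ S, F w ≤ F w' := by
  obtain ⟨w, hw, hmin⟩ := hF.lowerSemicontinuousOn K |>.exists_isMinOn ⟨w₀, hw₀⟩ hK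
  refine ⟨w, hw, fun w' hw' => ?_⟩
  by_cases h : w' ∈ K
  · exact hmin h
  · exact (hmin hw₀).trans (hout w' hw' h)

/-- Passing to the limit in `F (u k) ≤ a k`. -/
theorem le_of_tendsto_of_lowerSemicontinuous {W : Type*} [TopologicalSpace W]
    {F : W → EReal} (hF : LowerSemicontinuous F) {u : ℕ → W} {a : ℕ → ℝ} {u₀ : W} {a₀ : ℝ}
    (hu : Tendsto u atTop (𝓝 u₀)) (ha : Tendsto a atTop (𝓝 a₀)) (h : ∀ k, F (u k) ≤ (a k : EReal)) :
    F u₀ ≤ (a₀ : EReal) :=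
  hF.isClosed_epigraph.mem_of_tendsto
    (hu.prodMk_nhds (continuous_coe_real_ereal.tendsto a₀ |>.comp ha)) (Eventually.of_forall h)

/-! ### The subderivative -/

section

variable {V : Type*} [NormedAddCommGroup V] [InnerProductSpace ℝ V]

/-- If `F` is minorized around `u` by the concave paraboloid through `(u, F u)` of slope `-r`, then
`dF(u)(w) ≥ -⟨r, w⟩`. -/
theorem neg_inner_le_subderivative {F : V → EReal} {u r : V} {κ a : ℝ} (hu : F u = (a : EReal))
    (h : ∀ v, ((a - inner ℝ r (v - u) - κ * ‖v - u‖ ^ 2 : ℝ) : EReal) ≤ F v) (w : V) :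
    ((-inner ℝ r w : ℝ) : EReal) ≤ subderivative F u w := by
  set φ : ℝ × V → ℝ := fun q => -inner ℝ r q.2 - κ * (q.1 * ‖q.2‖ ^ 2) with hφ
  have hcont : Continuous φ := by fun_prop
  have hlim : Tendsto (fun q => (φ q : EReal)) (𝓝[>] (0 : ℝ) ×ˢ 𝓝 w)
      (𝓝 ((-inner ℝ r w : ℝ) : EReal)) := by
    have h1 := (continuous_coe_real_ereal.comp hcont).tendsto ((0 : ℝ), w)
    simp only [hφ, Function.comp, zero_mul, mul_zero, sub_zero] at h1
    rw [nhds_prod_eq] at h1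
    exact h1.mono_left (Filter.prod_mono nhdsWithin_le_nhds le_rfl)
  rw [← hlim.liminf_eq]
  refine liminf_le_liminf ?_
  have hpos : ∀ᶠ q : ℝ × V in 𝓝[>] (0 : ℝ) ×ˢ 𝓝 w, 0 < q.1 :=
    (tendsto_fst (f := 𝓝[>] (0 : ℝ)) (g := 𝓝 w)).eventually self_mem_nhdsWithin
  filter_upwards [hpos] with q hq
  have h1 := h (u + q.1 • q.2)
  rw [add_sub_cancel_left, inner_smul_right, norm_smul, Real.norm_of_nonneg hq.le, mul_pow] at h1
  have h2 : ((q.1 * φ q : ℝ) : EReal) ≤ F (u + q.1 • q.2) - F u := by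
    rw [hu, EReal.le_sub_iff_add_le (Or.inl (EReal.coe_ne_bot _)) (Or.inl (EReal.coe_ne_top _)),
      ← EReal.coe_add]
    refine le_trans (le_of_eq ?_) h1
    congr 1
    simp only [hφ]; ring
  calc (φ q : EReal) = ((q.1⁻¹ : ℝ) : EReal) * ((q.1 * φ q : ℝ) : EReal) := by
        rw [← EReal.coe_mul, inv_mul_cancel_left₀ hq.ne']
    _ ≤ _ := mul_le_mul_of_nonneg_left h2 (EReal.coe_nonneg.2 (inv_nonneg.2 hq.le))

/-- The Fenchel–Young inequality for `f_γ`, at a point where the radial subderivative is bounded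
below. -/
theorem inner_sub_le_of_le_subderivative {F : V → EReal} {γ a c C : ℝ} {u h : V} (hγ : 0 ≤ γ)
    (hu : F u = (a : EReal)) (hc : (c : EReal) ≤ subderivative F u u)
    (hC : conjugate (fGamma F γ) h ≤ (C : EReal)) : inner ℝ h u - C ≤ a - γ * c := by
  have hdom : u ∈ dom F := by simp [dom, hu]
  have h1 : fGamma F γ u ≤ ((a - γ * c : ℝ) : EReal) := by
    rw [fGamma, if_pos hdom, hu, EReal.coe_sub, EReal.coe_mul]
    exact EReal.sub_le_sub le_rfl (mul_le_mul_of_nonneg_left hc (EReal.coe_nonneg.2 hγ))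
  have h2 : ((inner ℝ h u - (a - γ * c) : ℝ) : EReal) ≤ (C : EReal) := by
    refine le_trans ?_ ((le_iSup (fun u => ((inner ℝ h u : ℝ) : EReal) - fGamma F γ u) u).trans hC)
    rw [EReal.coe_sub]
    exact EReal.sub_le_sub le_rfl h1
  have := EReal.coe_le_coe_iff.1 h2
  linarith

end

/-! ### Approximate stationarity by penalization -/

section

variable {V H : Type*} [NormedAddCommGroup V] [InnerProductSpace ℝ V]
  [NormedAddCommGroup H] [InnerProductSpace ℝ H]

/-- The real part of the penalized cost at `q = (r, β)`, where `r = u - A β` is the residual of the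
relaxed constraint `u = A β`; the proximal term singles out the minimizer `b`. -/
noncomputable def penalty (φ : H →L[ℝ] ℝ) (b : H) (κ : ℝ) (q : V × H) : ℝ :=
  φ q.2 + κ / 2 * ‖q.1‖ ^ 2 + 1 / 2 * ‖q.2 - b‖ ^ 2

/-- The first-order condition for the penalized problem along the ray through `β`, with
`u = A β + r` kept fixed. -/
theorem penalty_stationary {φ : H →L[ℝ] ℝ} {A : H →L[ℝ] V} {b β : H} {r : V} {κ : ℝ}
    (h : ∀ t : ℝ, 0 < t →
      penalty φ b κ (r, β) ≤ penalty φ b κ (r - t • A β, β + t • β)) :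
    κ * inner ℝ r (A β) ≤ φ β + inner ℝ (β - b) β := by
  set D := φ β + inner ℝ (β - b) β - κ * inner ℝ r (A β) with hD
  set E := κ / 2 * ‖A β‖ ^ 2 + 1 / 2 * ‖β‖ ^ 2 with hE
  have hexp : ∀ t : ℝ, 0 < t → 0 ≤ D + t * E := by
    intro t ht
    have h1 := h t ht
    simp only [penalty, map_add, map_smul, smul_eq_mul] at h1
    rw [norm_sub_sq_real r (t • A β), add_sub_right_comm, norm_add_sq_real (β - b), inner_smul_right, inner_smul_right,
      norm_smul, norm_smul, mul_pow, mul_pow, Real.norm_of_nonneg ht.le] at h1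
    have h2 : 0 ≤ t * (D + t * E) := by rw [hD, hE]; linarith
    exact nonneg_of_mul_nonneg_right h2 ht
  have hlim : Tendsto (fun t : ℝ => D + t * E) (𝓝[>] 0) (𝓝 (D + 0 * E)) :=
    ((by fun_prop : Continuous fun t : ℝ => D + t * E).tendsto 0).mono_left nhdsWithin_le_nhds
  have h0 : 0 ≤ D + 0 * E := ge_of_tendsto hlim (by
    filter_upwards [self_mem_nhdsWithin] with t ht using hexp t ht)
  linarith

variable [FiniteDimensional ℝ V] [FiniteDimensional ℝ H]

/-- The penalized problem, in which the constraint `u = A β` is relaxed to a quadratic penalty with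
weight `κ`, has a solution in a compact set that does not depend on `κ ≥ 1`. -/
theorem exists_penalized_minimizer {f : V → EReal} (hf : LowerSemicontinuous f) {m v : ℝ}
    (hm : ∀ u, (m : EReal) ≤ f u) (A : H →L[ℝ] V) (φ : H →L[ℝ] ℝ) {S : Set H} (hS : IsClosed S)
    (hφ : ∀ β ∈ S, 0 ≤ φ β) {b : H} (hb : b ∈ S) (hv : f (A b) = (v : EReal)) {κ : ℝ}
    (hκ : 1 ≤ κ) :
    ∃ q ∈ Metric.closedBall (0 : V) √(2 * (v + φ b - m)) ×ˢ
        (Metric.closedBall b √(2 * (v + φ b - m)) ∩ S),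
      ∀ q' : V × H, q'.2 ∈ S →
        f (A q.2 + q.1) + (penalty φ b κ q : EReal) ≤
          f (A q'.2 + q'.1) + (penalty φ b κ q' : EReal) := by
  set R := √(2 * (v + φ b - m)) with hR
  have hmv : 0 ≤ v + φ b - m := by
    have h1 := hm (A b)
    rw [hv, EReal.coe_le_coe_iff] at h1
    have := hφ b hb
    linarith
  have hR2 : R ^ 2 = 2 * (v + φ b - m) := Real.sq_sqrt (by linarith)
  have hlsc : LowerSemicontinuous fun q : V × H =>
      f (A q.2 + q.1) + (penalty φ b κ q : EReal) :=
    lowerSemicontinuous_add_coe (hf.comp (g := fun q : V × H => A q.2 + q.1) (by fun_prop))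
      (by unfold penalty; fun_prop)
  refine exists_forall_le_of_isCompact (S := {q : V × H | q.2 ∈ S}) hlsc
    ((isCompact_closedBall _ _).prod ((isCompact_closedBall _ _).inter_right hS))
    (w₀ := ((0 : V), b)) ?_ ?_
  · exact ⟨by simp [hR], by simp [hR], hb⟩
  · rintro ⟨r, β⟩ hβ hq
    have hβ : β ∈ S := hβ
    have key : v + φ b ≤ m + penalty φ b κ (r, β) := by
      have h0 := hφ β hβ
      have hfar : R < ‖r‖ ∨ R < ‖β - b‖ := by
        by_contra! hcon
        exact hq ⟨by simpa using hcon.1, by simpa [dist_eq_norm] using hcon.2, hβ⟩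
      have hR0 : 0 ≤ R := Real.sqrt_nonneg _
      simp only [penalty]
      rcases hfar with h1 | h1
      · nlinarith [sq_nonneg ‖β - b‖, mul_nonneg (sub_nonneg.2 hκ) (sq_nonneg ‖r‖)]
      · nlinarith [mul_nonneg (zero_le_one.trans hκ) (sq_nonneg ‖r‖)]
    calc f (A b + 0) + (penalty φ b κ ((0 : V), b) : EReal) = ((v + φ b : ℝ) : EReal) := by
          simp [penalty, hv]
      _ ≤ ((m + penalty φ b κ (r, β) : ℝ) : EReal) := EReal.coe_le_coe_iff.2 key
      _ ≤ _ := by rw [EReal.coe_add]; exact add_le_add_left (hm _) _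

/-- Approximate first-order condition. If `b` minimizes `β ↦ f (A β) + φ β` over a set `S` which is
stable under the maps `β ↦ (1 + t) β`, then `A b` is a limit of points `u k` with
`f (u k) → f (A b)` at which `df(u k)(u k)` is bounded below by numbers tending to `-φ b`.
At `A b` itself the bound may fail when no constraint qualification is imposed. -/
theorem exists_tendsto_le_subderivative {f : V → EReal} (hf : LowerSemicontinuous f) {m v : ℝ}
    (hm : ∀ u, (m : EReal) ≤ f u) (A : H →L[ℝ] V) (φ : H →L[ℝ] ℝ) {S : Set H} (hS : IsClosed S)
    (hφ : ∀ β ∈ S, 0 ≤ φ β) (hray : ∀ β ∈ S, ∀ t : ℝ, 0 < t → β + t • β ∈ S)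
    {b : H} (hb : b ∈ S) (hv : f (A b) = (v : EReal))
    (hmin : ∀ β ∈ S, ((v + φ b : ℝ) : EReal) ≤ f (A β) + (φ β : EReal)) :
    ∃ (u : ℕ → V) (a c : ℕ → ℝ), (∀ k, f (u k) = (a k : EReal)) ∧
      (∀ k, (c k : EReal) ≤ subderivative f (u k) (u k)) ∧ Tendsto u atTop (𝓝 (A b)) ∧
      Tendsto a atTop (𝓝 v) ∧ Tendsto c atTop (𝓝 (-φ b)) := by
  set R := √(2 * (v + φ b - m)) with hR
  have hκ : ∀ k : ℕ, (1 : ℝ) ≤ k + 1 := fun k => by linarith [k.cast_nonneg (α := ℝ)]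
  choose q hqK hqmin using fun k : ℕ => exists_penalized_minimizer hf hm A φ hS hφ hb hv (hκ k)
  have hle : ∀ k : ℕ, f (A (q k).2 + (q k).1) + (penalty φ b (k + 1) (q k) : EReal) ≤
      ((v + φ b : ℝ) : EReal) := fun k => (hqmin k (0, b) hb).trans (by simp [penalty, hv])
  have hbot : ∀ u, f u ≠ ⊥ := fun u => ne_bot_of_le_ne_bot (EReal.coe_ne_bot m) (hm u)
  have hfin : ∀ k, ∃ a : ℝ, f (A (q k).2 + (q k).1) = (a : EReal) := by
    intro k
    have htop : f (A (q k).2 + (q k).1) ≠ ⊤ := fun h => by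
      have := hle k
      rw [h, EReal.top_add_coe] at this
      exact absurd this (not_le.2 (EReal.coe_lt_top _))
    exact ⟨_, (EReal.coe_toReal htop (hbot _)).symm⟩
  choose a ha using hfin
  have hma : ∀ k, m ≤ a k := fun k => by
    have := hm (A (q k).2 + (q k).1)
    rwa [ha, EReal.coe_le_coe_iff] at this
  have hle' : ∀ k : ℕ, a k + penalty φ b (k + 1) (q k) ≤ v + φ b := fun k => by
    have := hle k
    rwa [ha, ← EReal.coe_add, EReal.coe_le_coe_iff] at this
  -- Stationarity in `β`, with `u` kept fixed.
  have hstat : ∀ k : ℕ, ((k : ℝ) + 1) * inner ℝ (q k).1 (A (q k).2) ≤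
      φ (q k).2 + inner ℝ ((q k).2 - b) (q k).2 := by
    intro k
    refine penalty_stationary fun t ht => ?_
    have h1 := hqmin k ((q k).1 - t • A (q k).2, (q k).2 + t • (q k).2)
      (hray _ (hqK k).2.2 t ht)
    rw [show A ((q k).2 + t • (q k).2) + ((q k).1 - t • A (q k).2) = A (q k).2 + (q k).1 by
      rw [map_add, map_smul]; abel, ha, ← EReal.coe_add, ← EReal.coe_add,
      EReal.coe_le_coe_iff] at h1
    linarith
  -- Stationarity in `u`, with `β` kept fixed.
  have hsub : ∀ k : ℕ, ((-(((k : ℝ) + 1) * ‖(q k).1‖ ^ 2 +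
      (φ (q k).2 + inner ℝ ((q k).2 - b) (q k).2)) : ℝ) : EReal) ≤
      subderivative f (A (q k).2 + (q k).1) (A (q k).2 + (q k).1) := by
    intro k
    refine le_trans (EReal.coe_le_coe_iff.2 ?_) (neg_inner_le_subderivative
      (r := ((k : ℝ) + 1) • (q k).1) (κ := ((k : ℝ) + 1) / 2) (ha k) (fun w => ?_) _)
    · rw [real_inner_smul_left, inner_add_right, real_inner_self_eq_norm_sq]
      linarith [hstat k]
    · have h1 := hqmin k (w - A (q k).2, (q k).2) (hqK k).2.2
      rw [add_sub_cancel, ha, ← EReal.coe_add] at h1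
      rcases eq_or_ne (f w) ⊤ with htop | htop
      · rw [htop]; exact le_top
      · rw [← EReal.coe_toReal htop (hbot w)] at h1 ⊢
        rw [← EReal.coe_add, EReal.coe_le_coe_iff] at h1
        rw [EReal.coe_le_coe_iff]
        simp only [penalty] at h1
        rw [show w - A (q k).2 = (q k).1 + (w - (A (q k).2 + (q k).1)) by abel,
          norm_add_sq_real] at h1
        rw [real_inner_smul_left]
        linarith
  have hcompact : IsCompact (Metric.closedBall (0 : V) R ×ˢ (Metric.closedBall b R ∩ S)) :=
    (isCompact_closedBall _ _).prod ((isCompact_closedBall _ _).inter_right hS)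
  obtain ⟨⟨r₀, β₀⟩, hlimK, σ, hσ, hlim⟩ := hcompact.tendsto_subseq hqK
  have hr : Tendsto (fun k => (q (σ k)).1) atTop (𝓝 r₀) :=
    (continuous_fst.tendsto _).comp hlim
  have hβ : Tendsto (fun k => (q (σ k)).2) atTop (𝓝 β₀) :=
    (continuous_snd.tendsto _).comp hlim
  -- The penalty is bounded along the sequence, so the residual vanishes in the limit.
  have hr₀ : r₀ = 0 := by
    have hbound : ∀ k : ℕ, ‖(q (σ k)).1‖ ^ 2 ≤ 2 * (v + φ b - m) * ((k : ℝ) + 1)⁻¹ := by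
      intro k
      have hk : (k : ℝ) ≤ σ k := by exact_mod_cast hσ.id_le k
      have h1 := hle' (σ k)
      have h2 := hφ _ (hqK (σ k)).2.2
      simp only [penalty] at h1
      rw [← div_eq_mul_inv, le_div_iff₀ (by positivity)]
      nlinarith [hma (σ k), sq_nonneg ‖(q (σ k)).2 - b‖,
        mul_nonneg (sub_nonneg.2 hk) (sq_nonneg ‖(q (σ k)).1‖)]
    have h0 : Tendsto (fun k : ℕ => 2 * (v + φ b - m) * ((k : ℝ) + 1)⁻¹) atTop (𝓝 0) := by
      simpa using (tendsto_one_div_add_atTop_nhds_zero_nat (𝕜 := ℝ)).const_mul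
        (2 * (v + φ b - m))
    have h1 := le_of_tendsto_of_tendsto (hr.norm.pow 2) h0 (Eventually.of_forall hbound)
    exact norm_eq_zero.1 (pow_eq_zero_iff (two_ne_zero) |>.1 (le_antisymm h1 (sq_nonneg _)))
  subst hr₀
  have hu : Tendsto (fun k => A (q (σ k)).2 + (q (σ k)).1) atTop (𝓝 (A β₀)) := by
    simpa using ((A.continuous.tendsto _).comp hβ).add hr
  have hφlim : Tendsto (fun k => φ (q (σ k)).2) atTop (𝓝 (φ β₀)) :=
    (φ.continuous.tendsto _).comp hβ
  have hprox : Tendsto (fun k => 1 / 2 * ‖(q (σ k)).2 - b‖ ^ 2) atTop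
      (𝓝 (1 / 2 * ‖β₀ - b‖ ^ 2)) := ((hβ.sub_const b).norm.pow 2).const_mul _
  have hupper : Tendsto (fun k => v + φ b - φ (q (σ k)).2 - 1 / 2 * ‖(q (σ k)).2 - b‖ ^ 2) atTop
      (𝓝 (v + φ b - φ β₀ - 1 / 2 * ‖β₀ - b‖ ^ 2)) := (hφlim.const_sub _).sub hprox
  have hpen : ∀ k, 0 ≤ ((σ k : ℝ) + 1) / 2 * ‖(q (σ k)).1‖ ^ 2 := fun k => by positivity
  have ha_le : ∀ k, a (σ k) ≤ v + φ b - φ (q (σ k)).2 - 1 / 2 * ‖(q (σ k)).2 - b‖ ^ 2 := by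
    intro k
    have h1 := hle' (σ k)
    simp only [penalty] at h1
    linarith [hpen k]
  -- The proximal term forces the limit to be the given minimizer.
  have hβ₀ : β₀ = b := by
    have h1 : f (A β₀) ≤ ((v + φ b - φ β₀ - 1 / 2 * ‖β₀ - b‖ ^ 2 : ℝ) : EReal) :=
      le_of_tendsto_of_lowerSemicontinuous hf hu hupper fun k => by
        rw [ha]; exact EReal.coe_le_coe_iff.2 (ha_le k)
    have h2 := (hmin β₀ hlimK.2.2).trans (add_le_add_left h1 _)
    rw [← EReal.coe_add, EReal.coe_le_coe_iff] at h2
    have h3 : ‖β₀ - b‖ ^ 2 = 0 := le_antisymm (by linarith) (sq_nonneg _)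
    exact sub_eq_zero.1 (norm_eq_zero.1 (pow_eq_zero_iff two_ne_zero |>.1 h3))
  subst hβ₀
  have hav : Tendsto (fun k => a (σ k)) atTop (𝓝 v) := by
    refine tendsto_order.2 ⟨fun d hd => ?_, fun d hd => ?_⟩
    · have h0 : (d : EReal) < f (A β₀) := by rw [hv]; exact EReal.coe_lt_coe_iff.2 hd
      filter_upwards [hu.eventually (hf (A β₀) _ h0)] with k hk
      have hk : (d : EReal) < f (A (q (σ k)).2 + (q (σ k)).1) := hk
      rwa [ha, EReal.coe_lt_coe_iff] at hk
    · have h1 : Tendsto (fun k => v + φ β₀ - φ (q (σ k)).2 -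
          1 / 2 * ‖(q (σ k)).2 - β₀‖ ^ 2) atTop (𝓝 v) := by simpa using hupper
      filter_upwards [h1.eventually (gt_mem_nhds hd)] with k hk using (ha_le k).trans_lt hk
  have hpen0 : Tendsto (fun k => ((σ k : ℝ) + 1) * ‖(q (σ k)).1‖ ^ 2) atTop (𝓝 0) := by
    have h1 : Tendsto (fun k => 2 * (v + φ β₀ - φ (q (σ k)).2 - a (σ k))) atTop (𝓝 0) := by
      simpa using ((hφlim.const_sub (v + φ β₀)).sub hav).const_mul 2
    refine squeeze_zero (fun k => by positivity) (fun k => ?_) h1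
    have h2 := hle' (σ k)
    simp only [penalty] at h2
    linarith [sq_nonneg ‖(q (σ k)).2 - β₀‖]
  refine ⟨fun k => A (q (σ k)).2 + (q (σ k)).1, fun k => a (σ k), _, fun k => ha _,
    fun k => hsub (σ k), hu, hav, ?_⟩
  have hin : Tendsto (fun k => (inner ℝ ((q (σ k)).2 - β₀) (q (σ k)).2 : ℝ)) atTop (𝓝 0) := by
    simpa using (hβ.sub_const β₀).inner hβ (𝕜 := ℝ)
  simpa using (hpen0.add (hφlim.add hin)).neg

end

/-! ### The optimization problem -/

section

variable {n p : ℕ}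

theorem apply_eq_sum (X : Matrix (Fin n) (Fin p) ℝ) (β : Fin p → ℝ) :
    apply X β = ∑ i, β i • column X i := by
  ext k
  simp [apply, column, Matrix.mulVec, dotProduct, mul_comm]

theorem continuous_apply (X : Matrix (Fin n) (Fin p) ℝ) : Continuous (apply X) := by
  simp_rw [funext (apply_eq_sum X)]
  fun_prop

/-- The reference point of the star condition minimizes the loss: the loss does not increase along
the segment towards `y`, and it is lower semicontinuous at `y`. -/
theorem StarCondition.le {V : Type*} [NormedAddCommGroup V] [InnerProductSpace ℝ V] {f : V → EReal}
    {y : V} {ψL : ℝ} (hstar : StarCondition f y ψL) (hf : LowerSemicontinuous f) (u : V) :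
    f y ≤ f u := by
  by_contra! hlt
  have hu : u ∈ dom f := hlt.trans_le le_top
  have hlim : Tendsto (fun l : ℝ => l • u + (1 - l) • y) (𝓝[>] 0) (𝓝 y) := by
    have h1 : Continuous fun l : ℝ => l • u + (1 - l) • y := by fun_prop
    simpa using (h1.tendsto 0).mono_left nhdsWithin_le_nhds
  have hlt1 : ∀ᶠ l : ℝ in 𝓝[>] 0, l < 1 := nhdsWithin_le_nhds (gt_mem_nhds one_pos)
  obtain ⟨l, hl1, hl2, hl3⟩ :=
    ((hlim.eventually (hf y _ hlt)).and (hlt1.and self_mem_nhdsWithin)).exists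
  exact absurd (hstar.nondecreasing u hu l hl3 hl2) (not_le.2 hl1)

/-- Since the loss is bounded below and `η > 0`, a feasible problem has an optimal solution. -/
theorem optimalSolutions_nonempty {X : Matrix (Fin n) (Fin p) ℝ}
    {f : EuclideanSpace ℝ (Fin n) → EReal} (hf : LowerSemicontinuous f) {m : ℝ}
    (hm : ∀ u, (m : EReal) ≤ f u) {η : ℝ} (hη : 0 < η)
    (hfeas : ∃ β : Fin p → ℝ, 0 ≤ β ∧ apply X β ∈ dom f) :
    (optimalSolutions (cost X f η) (orthant p)).Nonempty := by
  obtain ⟨β₀, hβ₀, hdom⟩ := hfeas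
  obtain ⟨v, hv⟩ : ∃ v : ℝ, f (apply X β₀) = (v : EReal) :=
    ⟨_, (EReal.coe_toReal (ne_of_lt hdom) (ne_bot_of_le_ne_bot (EReal.coe_ne_bot m) (hm _))).symm⟩
  set M := (v + η * ∑ i, β₀ i - m) / η with hM
  have hlsc : LowerSemicontinuous (cost X f η) :=
    lowerSemicontinuous_add_coe (hf.comp (continuous_apply X)) (by fun_prop)
  have hmv : m ≤ v := by
    have := hm (apply X β₀)
    rwa [hv, EReal.coe_le_coe_iff] at this
  have hβ₀K : β₀ ∈ Icc (0 : Fin p → ℝ) (fun _ => M) := by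
    refine ⟨hβ₀, fun i => ?_⟩
    have h1 := Finset.single_le_sum (fun j _ => hβ₀ j) (Finset.mem_univ i)
    rw [hM, le_div_iff₀ hη]
    nlinarith
  obtain ⟨β, hβ, hmin⟩ := exists_forall_le_of_isCompact (S := orthant p) hlsc
    (isCompact_Icc (a := (0 : Fin p → ℝ)) (b := fun _ => M)) hβ₀K (fun w hw hwK => by
      obtain ⟨i, hi⟩ : ∃ i, M < w i := by
        by_contra! hcon
        exact hwK ⟨hw, hcon⟩
      have h1 := Finset.single_le_sum (fun j _ => hw j) (Finset.mem_univ i)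
      have h2 : v + η * ∑ j, β₀ j ≤ m + η * ∑ j, w j := by
        rw [hM, div_lt_iff₀ hη] at hi
        nlinarith
      calc cost X f η β₀ = ((v + η * ∑ j, β₀ j : ℝ) : EReal) := by
            rw [cost, hv, EReal.coe_add]
        _ ≤ ((m + η * ∑ j, w j : ℝ) : EReal) := EReal.coe_le_coe_iff.2 h2
        _ ≤ _ := by rw [EReal.coe_add]; exact add_le_add_left (hm _) _)
  refine ⟨β, hβ.1, (hmin β₀ hβ₀).trans_lt ?_, hmin⟩
  rw [cost, hv, ← EReal.coe_add]
  exact EReal.coe_lt_top _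

/-- The Fenchel–Young inequality for `f_γ` combined with the first-order condition at an optimal
solution. It is the limit of the inequalities at the approximately stationary points. -/
theorem inner_sub_le_of_mem_optimalSolutions {X : Matrix (Fin n) (Fin p) ℝ}
    {f : EuclideanSpace ℝ (Fin n) → EReal} (hf : LowerSemicontinuous f) {m : ℝ}
    (hm : ∀ u, (m : EReal) ≤ f u) {η : ℝ} (hη : 0 < η) {γ C v : ℝ} (hγ : 0 ≤ γ)
    {h : EuclideanSpace ℝ (Fin n)} (hC : conjugate (fGamma f γ) h ≤ (C : EReal)) {β : Fin p → ℝ}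
    (hβ : β ∈ optimalSolutions (cost X f η) (orthant p)) (hv : f (apply X β) = (v : EReal)) :
    inner ℝ h (apply X β) - C ≤ v + γ * (η * ∑ i, β i) := by
  set A : EuclideanSpace ℝ (Fin p) →L[ℝ] EuclideanSpace ℝ (Fin n) :=
    (Matrix.toEuclideanLin X).toContinuousLinearMap
  have hA : ∀ b, A b = apply X b := fun b => rfl
  set φ : EuclideanSpace ℝ (Fin p) →L[ℝ] ℝ := η • ∑ i, EuclideanSpace.proj i with hφ_def
  have hφ : ∀ b, φ b = η * ∑ i, b i := fun b => by
    simp [hφ_def]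
  have hclosed : IsClosed {b : EuclideanSpace ℝ (Fin p) | ∀ i, 0 ≤ b i} := by
    simp only [Set.ofPred_forall]
    exact isClosed_iInter fun i => isClosed_le (by fun_prop) (by fun_prop)
  have hb : ∀ i, 0 ≤ WithLp.toLp 2 β i := hβ.1
  obtain ⟨u, a, c, ha, hc, hulim, halim, hclim⟩ :=
    exists_tendsto_le_subderivative hf hm A φ hclosed
      (fun b hb => by rw [hφ]; exact mul_nonneg hη.le (Finset.sum_nonneg fun i _ => hb i))
      (fun b hb t ht i => add_nonneg (hb i) (mul_nonneg ht.le (hb i)))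
      (b := WithLp.toLp 2 β) hb (v := v) (by rw [hA]; exact hv)
      (fun b hb => by
        have h1 := hβ.2.2 b hb
        rw [cost, hv, ← EReal.coe_add] at h1
        rw [hφ, hφ, hA]
        exact h1)
  have hle : ∀ k, inner ℝ h (u k) - C ≤ a k - γ * c k := fun k =>
    inner_sub_le_of_le_subderivative hγ (ha k) (hc k) hC
  have h1 := le_of_tendsto_of_tendsto (((tendsto_const_nhds (x := h)).inner hulim).sub_const C)
    (halim.sub (hclim.const_mul γ)) (Eventually.of_forall hle)
  rw [hA, hφ] at h1
  have h1 : inner ℝ h (apply X β) - C ≤ v - γ * -(η * ∑ i, β i) := h1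
  linarith

/-- If an optimal solution uses a column outside the extreme rays, its total weight is at most
`1 / α` and its cost at most `ψL + η / α`.

Rewriting `x i` by means of the other columns changes `X β` by a positive multiple of `y`; scaling
back produces a feasible point whose image lies on the segment from `X β` to `y`, to which the two
inequalities of the star condition apply. -/
theorem sum_le_and_cost_le_of_not_isExtremeRay {X : Matrix (Fin n) (Fin p) ℝ}
    {f : EuclideanSpace ℝ (Fin n) → EReal} {η : ℝ} (hη : 0 < η) {y : EuclideanSpace ℝ (Fin n)}
    {ψL : ℝ} (hstar : StarCondition f y ψL) {α : ℝ} (hα : 0 < α) (hver : VertexNonCover X (α • y))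
    {β : Fin p → ℝ} (hβ : β ∈ optimalSolutions (cost X f η) (orthant p)) {v : ℝ}
    (hv : f (apply X β) = (v : EReal)) {i : Fin p} (hi : β i ≠ 0)
    (hray : ¬ IsExtremeRay (shiftedCone X (α • y)) (ray (column X i - α • y))) :
    ∑ j, β j ≤ 1 / α ∧ v + η * ∑ j, β j ≤ ψL + η / α := by
  classical
  obtain ⟨l, hl0, hl1, hl⟩ := exists_sum_gt_one_of_not_isExtremeRay hver hray
  have hi0 : 0 < β i := lt_of_le_of_ne (hβ.1 i) hi.symm
  set s := ∑ j, β j with hs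
  set c := β i * (∑ j, l j - 1) * α with hc
  have hcpos : 0 < c := mul_pos (mul_pos hi0 (sub_pos.2 hl1)) hα
  set θ := 1 / (1 + c) with hθ
  have hθ0 : 0 < θ := by positivity
  have hθ1 : θ < 1 := by rw [hθ, div_lt_one (by linarith)]; linarith
  have hθc : θ * c = 1 - θ := by rw [hθ]; field_simp; ring
  -- `x i` is replaced by its combination of columns, and `θ` is the scaling that brings
  -- `u + c y` back to the segment from `u = X β` to `y`.
  set β' : Fin p → ℝ := fun j => θ * (β j - Pi.single (M := fun _ => ℝ) i (β i) j + β i * l j)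
    with hβ'
  have hβ'0 : β' ∈ orthant p := by
    intro j
    have h1 : 0 ≤ β j - Pi.single (M := fun _ => ℝ) i (β i) j := by
      by_cases hj : j = i
      · subst hj; simp
      · simpa [hj] using hβ.1 j
    exact mul_nonneg hθ0.le (add_nonneg h1 (mul_nonneg hi0.le (hl0 j)))
  have hsum : ∑ j, β' j = θ * s + (1 - θ) / α := by
    rw [hβ', ← Finset.mul_sum, Finset.sum_add_distrib, Finset.sum_sub_distrib,
      Finset.sum_pi_single', if_pos (Finset.mem_univ i), ← Finset.mul_sum, ← hs, ← hθc, hc]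
    field_simp
    ring
  have hX : apply X β' = θ • apply X β + (1 - θ) • y := by
    have h1 : ∑ j, l j • (column X j - α • y) =
        ∑ j, l j • column X j - (∑ j, l j) • (α • y) := by
      simp only [smul_sub, Finset.sum_sub_distrib, Finset.sum_smul]
    have h2 : ∑ j, l j • column X j = column X i + (∑ j, l j - 1) • (α • y) := by
      rw [sub_smul, one_smul]
      have h3 := hl.trans h1
      rw [eq_sub_iff_add_eq] at h3
      rw [← h3]; abel
    have h4 : ∑ j, Pi.single (M := fun _ => ℝ) i (β i) j • column X j = β i • column X i := by
      rw [Finset.sum_eq_single i] <;> simp +contextual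
    have hy : (1 - θ) • y = θ • β i • (∑ j, l j - 1) • (α • y) := by
      rw [← hθc, hc]; module
    rw [apply_eq_sum, apply_eq_sum, hy]
    simp only [hβ', mul_smul, add_smul, sub_smul, ← Finset.smul_sum, Finset.sum_add_distrib,
      Finset.sum_sub_distrib, h2, h4]
    module
  have hdom : apply X β ∈ dom f := by simp [dom, hv]
  have hstep : ∀ v' : ℝ, f (θ • apply X β + (1 - θ) • y) ≤ (v' : EReal) →
      v + η * s ≤ v' + η * (θ * s + (1 - θ) / α) := by
    intro v' hv'
    have h1 := hβ.2.2 β' hβ'0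
    rw [cost, cost, hv, hX, hsum, ← EReal.coe_add] at h1
    have h2 := h1.trans (add_le_add_left hv' _)
    rwa [← EReal.coe_add, EReal.coe_le_coe_iff] at h2
  constructor
  · have h1 := hstep v (hv ▸ hstar.nondecreasing _ hdom θ hθ0 hθ1)
    have h2 : s * (1 - θ) ≤ 1 / α * (1 - θ) := by
      have : η * s ≤ η * (θ * s + (1 - θ) / α) := by linarith
      have := le_of_mul_le_mul_left this hη
      rw [div_eq_mul_one_div] at this
      linarith
    exact le_of_mul_le_mul_right h2 (by linarith)
  · have h0 := hstar.epi_star _ hdom θ hθ0 hθ1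
    rw [hv, ← EReal.coe_sub, ← EReal.coe_mul,
      EReal.sub_le_iff_le_add (Or.inl (EReal.coe_ne_bot _)) (Or.inl (EReal.coe_ne_top _)),
      ← EReal.coe_add] at h0
    have h1 := hstep _ h0
    have h2 : (v + η * s) * (1 - θ) ≤ (ψL + η / α) * (1 - θ) := by
      have : η * ((1 - θ) / α) = η / α * (1 - θ) := by ring
      linarith
    exact le_of_mul_le_mul_right h2 (by linarith)

/-- Restricting a minimization problem that has solutions to a smaller constraint set containing all
of them changes neither the optimal value nor the set of solutions. -/
theorem optimalValue_eq_and_optimalSolutions_eq {V : Type*} {F : V → EReal} {S S' : Set V}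
    (hsub : S' ⊆ S) (hne : (optimalSolutions F S).Nonempty) (hopt : optimalSolutions F S ⊆ S') :
    optimalValue F S = optimalValue F S' ∧ optimalSolutions F S = optimalSolutions F S' := by
  obtain ⟨b, hb⟩ := hne
  refine ⟨le_antisymm (biInf_mono hsub) ?_, Subset.antisymm ?_ ?_⟩
  · exact le_iInf₂ fun w hw => (iInf₂_le b (hopt hb)).trans (hb.2.2 w hw)
  · exact fun w hw => ⟨hopt hw, hw.2.1, fun w' hw' => hw.2.2 w' (hsub hw')⟩
  · exact fun w hw => ⟨hsub hw.1, hw.2.1, fun w' hw' => (hw.2.2 b (hopt hb)).trans (hb.2.2 w' hw')⟩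

end

end PersistentReduction

/-! ### The reduction -/

theorem mainTheorem1 {n p : ℕ} (hp : 1 ≤ p)
    (X : Matrix (Fin n) (Fin p) ℝ)
    (f : EuclideanSpace ℝ (Fin n) → EReal) (hf_proper : IsProper f) (hf_lsc : LowerSemicontinuous f)
    (η : ℝ) (hη : 0 < η)
    (y : EuclideanSpace ℝ (Fin n)) (ψL : ℝ) (hstar : StarCondition f y ψL)
    (γ : ℝ) (hγ0 : 0 ≤ γ) (hγ1 : γ ≤ 1)
    (h : EuclideanSpace ℝ (Fin n)) (hh : h ∈ dom (conjugate (fGamma f γ)))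
    (α : ℝ) (hα : 0 < α)
    (hη_lower : (1 - γ) * η ≤ -(⨅ i : Fin p, inner ℝ (column X i) h))
    (hη_upper : ((-(⨅ i : Fin p, inner ℝ (column X i) h) : ℝ) : EReal) <
      (α : EReal) * (-(conjugate (fGamma f γ) h) - (ψL : EReal)) - ((γ * η : ℝ) : EReal))
    (hver : VertexNonCover X (α • y))
    (hopt : OptimalityAssumptions X f η)
    (I : Set (Fin p))
    (hI : ∀ i : Fin p, IsExtremeRay (shiftedCone X (α • y)) (ray (column X i - α • y)) → i ∈ I) :
    optimalValue (cost X f η) (orthant p) = optimalValue (cost X f η) (restrictedOrthant I) ∧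
    optimalSolutions (cost X f η) (orthant p) =
      optimalSolutions (cost X f η) (restrictedOrthant I) ∧
    (∀ β ∈ optimalSolutions (cost X f η) (orthant p), ∀ i : Fin p, β i ≠ 0 → i ∈ I) := by
  -- A real upper bound of the conjugate for which the upper bound on `η` is still strict.
  obtain ⟨C, hC, hCη⟩ : ∃ C : ℝ, conjugate (fGamma f γ) h ≤ (C : EReal) ∧
      -(⨅ i : Fin p, inner ℝ (column X i) h) < α * (-C - ψL) - γ * η := by
    rcases eq_or_ne (conjugate (fGamma f γ) h) ⊥ with hbot | hbot
    · refine ⟨-ψL - (-(⨅ i : Fin p, inner ℝ (column X i) h) + γ * η + 1) / α, by simp [hbot], ?_⟩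
      have h1 : α * ((-(⨅ i : Fin p, inner ℝ (column X i) h) + γ * η + 1) / α) =
        -(⨅ i : Fin p, inner ℝ (column X i) h) + γ * η + 1 := by field_simp
      linarith
    · obtain ⟨C, hC⟩ : ∃ C : ℝ, conjugate (fGamma f γ) h = (C : EReal) :=
        ⟨_, (EReal.coe_toReal (ne_of_lt hh) hbot).symm⟩
      refine ⟨C, hC.le, ?_⟩
      rw [hC, ← EReal.coe_neg, ← EReal.coe_sub, ← EReal.coe_mul, ← EReal.coe_sub,
        EReal.coe_lt_coe_iff] at hη_upper
      exact hη_upper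
  have hmin := fun u => hstar.le hf_lsc u
  obtain ⟨m, hm⟩ : ∃ m : ℝ, f y = (m : EReal) :=
    ⟨_, (EReal.coe_toReal (ne_of_lt hstar.mem_dom) (hf_proper.1 y)).symm⟩
  simp only [hm] at hmin
  have hsupp : ∀ β ∈ optimalSolutions (cost X f η) (orthant p), ∀ i : Fin p, β i ≠ 0 → i ∈ I := by
    intro β hβ i hi
    by_contra hiI
    obtain ⟨v, hv⟩ : ∃ v : ℝ, f (apply X β) = (v : EReal) := by
      refine ⟨_, (EReal.coe_toReal (fun htop => ?_) (hf_proper.1 _)).symm⟩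
      have h1 := hβ.2.1
      rw [cost, htop, EReal.top_add_coe] at h1
      exact lt_irrefl _ h1
    obtain ⟨hs, hcost⟩ := sum_le_and_cost_le_of_not_isExtremeRay hη hstar hα hver hβ hv hi
      fun hr => hiI (hI i hr)
    have hFY := inner_sub_le_of_mem_optimalSolutions hf_lsc hmin hη hγ0 hC hβ hv
    set μ := ⨅ i : Fin p, inner ℝ (column X i) h with hμ
    have hinner : μ * ∑ j, β j ≤ inner ℝ h (apply X β) := by
      rw [apply_eq_sum, inner_sum, Finset.mul_sum]
      refine Finset.sum_le_sum fun j _ => ?_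
      rw [inner_smul_right, real_inner_comm, mul_comm]
      exact mul_le_mul_of_nonneg_left (ciInf_le (Set.finite_range _).bddBelow j) (hβ.1 j)
    have h1 : ψL + (γ * η - μ) / α < -C := by
      have : (γ * η - μ) / α < -C - ψL := by rw [div_lt_iff₀ hα]; linarith
      linarith
    -- Both factors are nonpositive: the coefficient by the lower bound on `η`, and the total weight
    -- is at most `1 / α`.
    have h2 : 0 ≤ (-μ - (1 - γ) * η) * (1 / α - ∑ j, β j) :=
      mul_nonneg (by linarith) (by linarith)
    have h3 : η / α - (γ * η - μ) / α = -(-μ - (1 - γ) * η) * (1 / α) := by ring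
    nlinarith
  obtain ⟨h1, h2⟩ := optimalValue_eq_and_optimalSolutions_eq (S' := restrictedOrthant I)
    (fun β hβ => hβ.1) (optimalSolutions_nonempty hf_lsc hmin hη hopt.feasible)
    fun β hβ => ⟨hβ.1, fun i hi => by_contra fun h0 => hi (hsupp β hβ i h0)⟩
  exact ⟨h1, h2, hsupp⟩
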